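/- Let $q\ge 2$ be an integer and let $X$ be (the vertex set of) a $q$-homogeneous tree, that is, a tree in which every vertex has exactly $q+1$ neighbours. Fix an origin $o\in X$ and write $|x|=d(o,x)$. For real $\alpha>1$ let $\mu_\alpha$ be the measure on $X$ with density $q^{-\alpha|x|}$ with respect to the counting measure, and let $L^p_\alpha=L^p(X,\mu_\alpha;\mathbb C)$. A function $f\colon X\to\mathbb C$ is called harmonic if $f(v)=\frac1{q+1}\sum_{u\sim v}f(u)$ for every $v\in X$. Let $\mathcal A^2_\alpha$ be the closed subspace of $L^2_\alpha$ consisting of the harmonic functions in $L^2_\alpha$, and let $P_\alpha\colon L^2_\alpha\to\mathcal A^2_\alpha$ be the orthogonal projection (the Bergman projector). Then, for every $\alpha>1$, one has $L^2_\alpha\subseteq L^1_\alpha$, and $P_\alpha$ extends to an operator of weak type $(1,1)$ with respect to $\mu_\alpha$: there are a linear operator $T$ from $L^1_\alpha$ to the space of complex functions on $X$ with $Tf=P_\alpha f$ for every $f\in L^2_\alpha$, and a constant $C\geq 0$, such that $$\mu_\alpha\bigl(\{z\in X: |Tf(z)|>t\}\bigr)\le \frac{C}{t}\,\|f\|_{L^1_\alpha}\qquad\text{for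 all } f\in L^1_\alpha,\ t>0.$$ -/

import Mathlib

open MeasureTheory
open scoped ENNReal NNReal

noncomputable section

namespace BergmanTree

universe u

variable {X : Type u}

/-- A `q`-homogeneous tree: a connected acyclic graph in which every vertex has exactly `q + 1`
neighbours. -/
def IsHomogeneousTree (G : SimpleGraph X) [G.LocallyFinite] (q : ℕ) : Prop :=
  G.IsTree ∧ G.IsRegularOfDegree (q + 1)

/-- The combinatorial Laplacian `Lf(v) = f(v) - (q + 1)⁻¹ ∑_{u ∼ v} f(u)`. -/
def laplacian (G : SimpleGraph X) [G.LocallyFinite] (q : ℕ) (f : X → ℂ) (v : X) : ℂ :=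
  f v - ((q : ℂ) + 1)⁻¹ * ∑ u ∈ G.neighborFinset v, f u

/-- `f` is harmonic on the whole tree. -/
def IsHarmonic (G : SimpleGraph X) [G.LocallyFinite] (q : ℕ) (f : X → ℂ) : Prop :=
  ∀ v, laplacian G q f v = 0

/-- The density `q ^ (-α |x|)`, where `|x| = d(o, x)`. -/
def weight (G : SimpleGraph X) (q : ℕ) (o : X) (α : ℝ) (x : X) : ℝ :=
  (q : ℝ) ^ (-(α * (G.dist o x : ℝ)))

/-- The measure `μ_α` with density `q ^ (-α |x|)` with respect to the counting measure. -/
def mu [MeasurableSpace X] (G : SimpleGraph X) (q : ℕ) (o : X) (α : ℝ) : Measure X :=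
  Measure.count.withDensity fun x => ENNReal.ofReal (weight G q o α x)

theorem mu_singleton [MeasurableSpace X] [DiscreteMeasurableSpace X] (G : SimpleGraph X) (q : ℕ)
    (o : X) (α : ℝ) (x : X) : mu G q o α {x} = ENNReal.ofReal (weight G q o α x) := by
  rw [mu, withDensity_apply _ (measurableSet_singleton x), lintegral_singleton,
    Measure.count_singleton, mul_one]

theorem mu_singleton_ne_zero [MeasurableSpace X] [DiscreteMeasurableSpace X] (G : SimpleGraph X)
    (q : ℕ) [hq : Fact (2 ≤ q)] (o : X) (α : ℝ) (x : X) : mu G q o α {x} ≠ 0 := by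
  have h : (0 : ℝ) < q := by
    have := hq.out
    exact_mod_cast (by omega : 0 < q)
  rw [mu_singleton]
  exact (ENNReal.ofReal_pos.2 (Real.rpow_pos_of_pos h _)).ne'

/-- Since every vertex has positive mass, almost everywhere means everywhere. -/
theorem forall_of_ae [MeasurableSpace X] [DiscreteMeasurableSpace X] {G : SimpleGraph X} {q : ℕ}
    [Fact (2 ≤ q)] {o : X} {α : ℝ} {p : X → Prop} (h : ∀ᵐ x ∂(mu G q o α), p x) (x : X) : p x := by
  by_contra hx
  exact mu_singleton_ne_zero G q o α x
    (measure_mono_null (Set.singleton_subset_iff.2 hx) (ae_iff.1 h))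

/-- The harmonic Bergman space `𝒜²_α`: the harmonic functions in `L²_α`. -/
def bergmanSpace [MeasurableSpace X] [DiscreteMeasurableSpace X] (G : SimpleGraph X)
    [G.LocallyFinite] (q : ℕ) [Fact (2 ≤ q)] (o : X) (α : ℝ) :
    Submodule ℂ (Lp ℂ 2 (mu G q o α)) where
  carrier := {f | IsHarmonic G q f}
  zero_mem' := by
    intro v
    have h : ⇑(0 : Lp ℂ 2 (mu G q o α)) = 0 :=
      funext (forall_of_ae (Lp.coeFn_zero ℂ 2 (mu G q o α)))
    rw [laplacian, h]
    simp
  add_mem' := by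
    intro f g hf hg v
    have h := forall_of_ae (Lp.coeFn_add f g)
    have hf := hf v
    have hg := hg v
    simp only [laplacian, h, Pi.add_apply, Finset.sum_add_distrib] at hf hg ⊢
    linear_combination hf + hg
  smul_mem' := by
    intro c f hf v
    have h := forall_of_ae (Lp.coeFn_smul c f)
    have hf := hf v
    simp only [laplacian, h, Pi.smul_apply, smul_eq_mul, ← Finset.mul_sum] at hf ⊢
    linear_combination c * hf

theorem continuous_eval [MeasurableSpace X] [DiscreteMeasurableSpace X] (G : SimpleGraph X)
    (q : ℕ) [Fact (2 ≤ q)] (o : X) (α : ℝ) (x : X) :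
    Continuous fun f : Lp ℂ 2 (mu G q o α) => f x := by
  have hs : MeasurableSet ({x} : Set X) := measurableSet_singleton x
  have hfin : mu G q o α {x} ≠ ∞ := by
    rw [mu_singleton]
    exact ENNReal.ofReal_ne_top
  have hr : (mu G q o α).real {x} ≠ 0 :=
    (ENNReal.toReal_pos (mu_singleton_ne_zero G q o α x) hfin).ne'
  have key : (fun f : Lp ℂ 2 (mu G q o α) => f x) = fun f =>
      ((mu G q o α).real {x})⁻¹ • inner ℂ (indicatorConstLp 2 hs hfin (1 : ℂ)) f := by
    funext f
    rw [L2.inner_indicatorConstLp_one hs hfin f, integral_singleton, smul_smul,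
      inv_mul_cancel₀ hr, one_smul]
  rw [key]
  fun_prop

theorem isClosed_bergmanSpace [MeasurableSpace X] [DiscreteMeasurableSpace X] (G : SimpleGraph X)
    [G.LocallyFinite] (q : ℕ) [Fact (2 ≤ q)] (o : X) (α : ℝ) :
    IsClosed (bergmanSpace G q o α : Set (Lp ℂ 2 (mu G q o α))) := by
  have h : (bergmanSpace G q o α : Set (Lp ℂ 2 (mu G q o α))) =
      ⋂ v, {f : Lp ℂ 2 (mu G q o α) | laplacian G q f v = 0} := by
    ext f
    simp [bergmanSpace, IsHarmonic]
  rw [h]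
  refine isClosed_iInter fun v => isClosed_eq ?_ continuous_const
  unfold laplacian
  exact (continuous_eval G q o α v).sub
    (continuous_const.mul (continuous_finsetSum _ fun u _ => continuous_eval G q o α u))

instance hasOrthogonalProjection_bergmanSpace [MeasurableSpace X] [DiscreteMeasurableSpace X]
    (G : SimpleGraph X) [G.LocallyFinite] (q : ℕ) [Fact (2 ≤ q)] (o : X) (α : ℝ) :
    (bergmanSpace G q o α).HasOrthogonalProjection :=
  haveI : CompleteSpace (bergmanSpace G q o α) :=
    (isClosed_bergmanSpace G q o α).completeSpace_coe
  inferInstance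

/-- The Bergman projector `P_α`: the orthogonal projection of `L²_α` onto `𝒜²_α`, regarded as an
operator on `L²_α`. -/
def bergmanProjector [MeasurableSpace X] [DiscreteMeasurableSpace X] (G : SimpleGraph X)
    [G.LocallyFinite] (q : ℕ) [Fact (2 ≤ q)] (o : X) (α : ℝ) :
    Lp ℂ 2 (mu G q o α) →L[ℂ] Lp ℂ 2 (mu G q o α) :=
  (bergmanSpace G q o α).starProjection

/-- `T` is of weak type `(1,1)` with respect to `μ`: for some constant `C`, every `f ∈ L¹(μ)` and
every `t > 0` satisfy `μ {|T f| > t} ≤ C ‖f‖₁ / t`. -/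
def IsWeakTypeOneOne [MeasurableSpace X] (μ : Measure X) (T : Lp ℂ 1 μ → X → ℂ) : Prop :=
  ∃ C : ℝ≥0, ∀ (f : Lp ℂ 1 μ) (t : ℝ), 0 < t →
    μ {z | t < ‖T f z‖} ≤ ENNReal.ofReal (C * ‖f‖ / t)

end BergmanTree

end

/-! The point evaluation at `z` on harmonic functions is represented by a bounded real harmonic
kernel `K z`, built by telescoping along the geodesic from `o` to `z`. At the origin the mean value
property makes a constant kernel work. For `u ≠ o` with parent `p`, harmonicity fixes the sum of `g`
over each generation below `u` in terms of `g p` and `g u - g p` (`IsHarmonic.sum_generation`).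
Comparing the sector of `u` with the average over its siblings therefore isolates `g u - g p`, up to
`1/q` times the preceding increment (`represents_siblingKernel`). Since that factor is at most
`1/2`, the corrections accumulate geometrically, and `|K z x|` is at most a constant times the sum
of `q ^ (α |v|)` over the common ancestors `v` of `z` and `x`, each vertex counting among its own
ancestors (`exists_kernel`).

As `q ^ (-α |v|)` is comparable to the mass of the sector of `v`, the operator is dominated by a sum
over `j` of averages of `|f|` over the sector of the `j`-th ancestor. Call `v` heavy if this average
exceeds a level `s`. The sectors of the heavy vertices closest to `o` are disjoint, and the vertices
at least `j` generations below `v` carry only a fraction of order `ρ ^ j` of the mass of its sector,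
where `ρ = q ^ (1 - α) < 1`. So the `j`-th average satisfies a weak type bound with the gain `ρ ^ j`
(`mu_heavy_le`). This gain pays for geometrically decreasing levels and the bounds can be summed
over `j`.

Finally, a bounded harmonic kernel lies in the Bergman space, so self-adjointness of the projection
identifies the integral operator with `P_α` on `L²_α`. -/

noncomputable section

namespace BergmanTree

universe u

variable {X : Type u}

/-! ### The tree rooted at `o`: parents, generations, sectors -/

open Classical in
/-- The neighbour of `x` on the way to the origin `o`; the origin is its own parent. -/
def parent (G : SimpleGraph X) (o x : X) : X :=
  if h : ∃ y, G.Adj x y ∧ G.dist o x = G.dist o y + 1 then h.choose else x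

/-- The neighbours of `v` that are further away from the origin `o`. -/
def children (G : SimpleGraph X) [G.LocallyFinite] (o v : X) : Finset X :=
  (G.neighborFinset v).filter fun w => G.dist o w = G.dist o v + 1

open Classical in
/-- The descendants of `v` in the `k`-th generation. -/
def generation (G : SimpleGraph X) [G.LocallyFinite] (o v : X) : ℕ → Finset X
  | 0 => {v}
  | k + 1 => (generation G o v k).biUnion (children G o)

/-- The set of all descendants of `v`, including `v`. -/
def sector (G : SimpleGraph X) [G.LocallyFinite] (o v : X) : Set X :=
  ⋃ k, (generation G o v k : Set X)

section Tree

variable {G : SimpleGraph X} {o : X}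

theorem dist_eq_zero_iff_eq (hG : G.IsTree) {x : X} : G.dist o x = 0 ↔ x = o := by
  rw [hG.connected.dist_eq_zero_iff, eq_comm]

theorem exists_adj_dist_eq (hG : G.IsTree) {x : X} (hx : x ≠ o) :
    ∃ y, G.Adj x y ∧ G.dist o x = G.dist o y + 1 := by
  obtain ⟨p, hp⟩ := hG.connected.exists_walk_length_eq_dist x o
  cases p with
  | nil => exact absurd rfl hx
  | cons h p =>
    rename_i y
    refine ⟨y, h, ?_⟩
    have h1 := G.dist_le p
    have h2 := hG.dist_eq_dist_add_one_of_adj o h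
    rw [SimpleGraph.Walk.length_cons] at hp
    rw [G.dist_comm (u := o) (v := x), G.dist_comm (u := o) (v := y)] at *
    omega

theorem parent_spec (hG : G.IsTree) {x : X} (hx : x ≠ o) :
    G.Adj x (parent G o x) ∧ G.dist o x = G.dist o (parent G o x) + 1 := by
  have h := exists_adj_dist_eq hG hx
  rw [parent, dif_pos h]
  exact h.choose_spec

theorem parent_self : parent G o o = o := by
  rw [parent, dif_neg]
  rintro ⟨y, -, h⟩
  simp at h

/-- Truncated subtraction covers the origin, which is its own parent. -/
theorem dist_parent (hG : G.IsTree) (x : X) : G.dist o (parent G o x) = G.dist o x - 1 := by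
  by_cases hx : x = o
  · rw [hx, parent_self]; simp
  · have := (parent_spec hG hx).2
    omega

/-- A geodesic from `o` to a neighbour of `x` closer to `o` cannot pass through `x`. By acyclicity
that neighbour is then the penultimate vertex of a fixed geodesic from `o` to `x`. -/
theorem adj_unique_of_dist (hG : G.IsTree) {x y z : X} (hy : G.Adj x y) (hz : G.Adj x z)
    (hdy : G.dist o x = G.dist o y + 1) (hdz : G.dist o x = G.dist o z + 1) : y = z := by
  classical
  obtain ⟨p, hp, -⟩ := hG.connected.exists_path_of_dist o x
  have key : ∀ w, G.Adj x w → G.dist o x = G.dist o w + 1 → w = p.penultimate := by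
    intro w hw hd
    refine hG.isAcyclic.eq_penultimate_of_adj_end hp hw ?_
    obtain ⟨r, hr, hrl⟩ := hG.connected.exists_path_of_dist o w
    refine hG.isAcyclic.mem_support_of_ne_mem_support_of_adj_of_isPath hp hr hw fun hx => ?_
    have h1 := G.dist_le (r.takeUntil x hx)
    have h2 := r.length_takeUntil_le_length hx
    omega
  rw [key y hy hdy, key z hz hdz]

theorem eq_parent_iff (hG : G.IsTree) {x y : X} (h : G.dist o x = G.dist o y + 1) :
    parent G o x = y ↔ G.Adj x y := by
  have hx : x ≠ o := by
    rintro rfl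
    simp at h
  constructor
  · rintro rfl
    exact (parent_spec hG hx).1
  · intro hy
    exact adj_unique_of_dist hG (parent_spec hG hx).1 hy (parent_spec hG hx).2 h

theorem dist_iterate_parent (hG : G.IsTree) (x : X) (k : ℕ) :
    G.dist o ((parent G o)^[k] x) = G.dist o x - k := by
  induction k with
  | zero => simp
  | succ k ih => rw [Function.iterate_succ_apply', dist_parent hG, ih]; omega

variable [G.LocallyFinite]

theorem mem_children (hG : G.IsTree) {v x : X} :
    x ∈ children G o v ↔ G.dist o x = G.dist o v + 1 ∧ parent G o x = v := by
  rw [children, Finset.mem_filter, SimpleGraph.mem_neighborFinset, and_comm]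
  refine and_congr_right fun h => ?_
  rw [eq_parent_iff hG h, G.adj_comm]

theorem mem_generation (hG : G.IsTree) {v x : X} {k : ℕ} :
    x ∈ generation G o v k ↔ G.dist o x = G.dist o v + k ∧ (parent G o)^[k] x = v := by
  induction k generalizing x with
  | zero =>
    simp only [generation, Finset.mem_singleton, add_zero, Function.iterate_zero, id_eq]
    exact ⟨fun h => ⟨by rw [h], h⟩, fun h => h.2⟩
  | succ k ih =>
    simp only [generation, Finset.mem_biUnion, ih, mem_children hG, Function.iterate_succ_apply]
    constructor
    · rintro ⟨w, ⟨h1, h2⟩, h3, rfl⟩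
      exact ⟨by omega, h2⟩
    · rintro ⟨h1, h2⟩
      have := dist_parent (o := o) hG x
      exact ⟨parent G o x, ⟨by omega, h2⟩, by omega, rfl⟩

theorem mem_generation_iterate (hG : G.IsTree) {x : X} {k : ℕ} (hk : k ≤ G.dist o x) :
    x ∈ generation G o ((parent G o)^[k] x) k := by
  rw [mem_generation hG, dist_iterate_parent hG]
  exact ⟨by omega, rfl⟩

theorem mem_sector (hG : G.IsTree) {v x : X} :
    x ∈ sector G o v ↔ ∃ k, G.dist o x = G.dist o v + k ∧ (parent G o)^[k] x = v := by
  simp [sector, mem_generation hG]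

theorem sector_origin (hG : G.IsTree) : sector G o o = Set.univ := by
  refine Set.eq_univ_of_forall fun x => (mem_sector hG).2 ⟨G.dist o x, by simp, ?_⟩
  rw [← dist_eq_zero_iff_eq hG, dist_iterate_parent hG, Nat.sub_self]

theorem countable_of_isTree (hG : G.IsTree) (o : X) : Countable X := by
  rw [← Set.countable_univ_iff, ← sector_origin (o := o) hG]
  exact Set.countable_iUnion fun k => (generation G o o k).countable_toSet

theorem pairwise_disjoint_generation (hG : G.IsTree) (v : X) :
    Pairwise (Function.onFun Disjoint fun k => (generation G o v k : Set X)) := by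
  intro i j hij
  refine Set.disjoint_left.2 fun x hi hj => hij ?_
  have h1 := ((mem_generation hG).1 hi).1
  have h2 := ((mem_generation hG).1 hj).1
  omega

theorem pairwiseDisjoint_children (hG : G.IsTree) (s : Set X) :
    s.PairwiseDisjoint (children G o) := by
  intro v _ w _ hvw
  refine Finset.disjoint_left.2 fun x hv hw => hvw ?_
  rw [← ((mem_children hG).1 hv).2, ← ((mem_children hG).1 hw).2]

theorem sum_generation_succ {M : Type*} [AddCommMonoid M] (hG : G.IsTree) (f : X → M) (v : X)
    (k : ℕ) :
    ∑ x ∈ generation G o v (k + 1), f x =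
      ∑ w ∈ generation G o v k, ∑ x ∈ children G o w, f x := by
  classical
  rw [generation, Finset.sum_biUnion]
  exact pairwiseDisjoint_children hG _

theorem children_origin : children G o o = G.neighborFinset o := by
  refine Finset.filter_true_of_mem fun x hx => ?_
  rw [SimpleGraph.mem_neighborFinset] at hx
  rw [G.dist_self, zero_add, SimpleGraph.dist_eq_one_iff_adj.2 hx]

theorem neighborFinset_eq_cons (hG : G.IsTree) {v : X} (hv : v ≠ o) :
    G.neighborFinset v = (children G o v).cons (parent G o v)
      (fun h => by
        have h1 := ((mem_children hG).1 h).1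
        have h2 := (parent_spec hG hv).2
        omega) := by
  ext x
  rw [Finset.mem_cons, SimpleGraph.mem_neighborFinset]
  constructor
  · intro h
    rcases hG.dist_eq_dist_add_one_of_adj o h with h1 | h1
    · exact Or.inl ((eq_parent_iff hG h1).2 h).symm
    · exact Or.inr ((mem_children hG).2 ⟨h1, (eq_parent_iff hG h1).2 h.symm⟩)
  · rintro (rfl | h)
    · exact (parent_spec hG hv).1
    · rw [children, Finset.mem_filter, SimpleGraph.mem_neighborFinset] at h
      exact h.1

theorem sum_neighborFinset {M : Type*} [AddCommMonoid M] (hG : G.IsTree) {v : X} (hv : v ≠ o)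
    (f : X → M) :
    ∑ x ∈ G.neighborFinset v, f x = f (parent G o v) + ∑ x ∈ children G o v, f x := by
  rw [neighborFinset_eq_cons hG hv, Finset.sum_cons]

end Tree

/-! ### Counting descendants and summing harmonic functions over generations -/

section Homogeneous

variable {G : SimpleGraph X} [G.LocallyFinite] {q : ℕ} {o : X}

theorem card_children_origin (hG : IsHomogeneousTree G q) : (children G o o).card = q + 1 := by
  rw [children_origin]
  exact hG.2 o

theorem card_children (hG : IsHomogeneousTree G q) {v : X} (hv : v ≠ o) :
    (children G o v).card = q := by
  have h : (G.neighborFinset v).card = q + 1 := hG.2 v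
  rw [neighborFinset_eq_cons hG.1 hv, Finset.card_cons] at h
  omega

theorem card_children_le (hG : IsHomogeneousTree G q) (v : X) :
    (children G o v).card ≤ q + 1 := by
  by_cases hv : v = o
  · rw [hv, card_children_origin hG]
  · rw [card_children hG hv]
    omega

theorem ne_origin_of_mem_generation (hG : G.IsTree) {v x : X} {k : ℕ}
    (hx : x ∈ generation G o v k) (h : v ≠ o ∨ 0 < k) : x ≠ o := by
  rintro rfl
  have h1 := ((mem_generation hG).1 hx).1
  rw [G.dist_self] at h1
  have h2 : v = x := (dist_eq_zero_iff_eq hG).1 (by omega)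
  rcases h with h | h
  · exact h h2
  · omega

theorem card_generation_succ_le (hG : IsHomogeneousTree G q) (v : X) (k : ℕ) :
    (generation G o v (k + 1)).card ≤ (q + 1) * q ^ k := by
  induction k with
  | zero => simpa [generation] using card_children_le hG v
  | succ k ih =>
    rw [Finset.card_eq_sum_ones, sum_generation_succ hG.1]
    calc ∑ w ∈ generation G o v (k + 1), ∑ x ∈ children G o w, 1
        = ∑ w ∈ generation G o v (k + 1), q := by
          refine Finset.sum_congr rfl fun w hw => ?_
          rw [← Finset.card_eq_sum_ones,
            card_children hG (ne_origin_of_mem_generation hG.1 hw (Or.inr k.succ_pos))]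
      _ = (generation G o v (k + 1)).card * q := by simp
      _ ≤ (q + 1) * q ^ (k + 1) := by
          rw [pow_succ, ← mul_assoc]
          exact Nat.mul_le_mul_right q ih

/-- The factor 2 absorbs the extra child of the origin: `q + 1 ≤ 2 * q`. -/
theorem card_generation_le (hG : IsHomogeneousTree G q) (hq : 2 ≤ q) (v : X) (k : ℕ) :
    (generation G o v k).card ≤ 2 * q ^ k := by
  cases k with
  | zero => simp [generation]
  | succ k =>
    calc _ ≤ (q + 1) * q ^ k := card_generation_succ_le hG v k
      _ ≤ (2 * q) * q ^ k := Nat.mul_le_mul_right _ (by omega)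
      _ = 2 * q ^ (k + 1) := by ring

/-- The radial profile of the harmonic functions supported in a sector: `b 0 = 0` and
`b (n + 1) = 1 + b n / q`. -/
def profile (q : ℕ) : ℕ → ℝ
  | 0 => 0
  | n + 1 => 1 + profile q n / q

theorem profile_nonneg (n : ℕ) : 0 ≤ profile q n := by
  induction n with
  | zero => simp [profile]
  | succ n ih => rw [profile]; positivity

theorem profile_le_two (hq : 2 ≤ q) (n : ℕ) : profile q n ≤ 2 := by
  have hq' : (2 : ℝ) ≤ q := by exact_mod_cast hq
  induction n with
  | zero => simp [profile]
  | succ n ih =>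
    rw [profile]
    have : profile q n / q ≤ 1 := by
      rw [div_le_one (by linarith)]
      linarith
    linarith

theorem profile_one : profile q 1 = 1 := by simp [profile]

/-- This is harmonicity of a radial function at a vertex with one parent and `q` children. -/
theorem profile_recurrence (hq : 2 ≤ q) (n : ℕ) :
    ((q : ℝ) + 1) * profile q (n + 1) = profile q n + q * profile q (n + 2) := by
  have hq' : (q : ℝ) ≠ 0 := by
    have : q ≠ 0 := by omega
    exact_mod_cast this
  rw [profile, profile, profile]
  field_simp
  ring

theorem isHarmonic_iff {f : X → ℂ} :
    IsHarmonic G q f ↔ ∀ v, ((q : ℂ) + 1) * f v = ∑ u ∈ G.neighborFinset v, f u := by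
  have hq : ((q : ℂ) + 1) ≠ 0 := by exact_mod_cast q.succ_ne_zero
  refine forall_congr' fun v => ?_
  rw [laplacian, sub_eq_zero, eq_inv_mul_iff_mul_eq₀ hq]

/-- Summing the harmonicity equations over a generation gives a linear second-order recurrence for
the generation sums, solved by `q ^ k` and `q ^ k * profile q (k + 1)`. The values at `u` and its
parent are the initial data. -/
theorem IsHarmonic.sum_generation (hG : IsHomogeneousTree G q) (hq : 2 ≤ q) {g : X → ℂ}
    (hg : IsHarmonic G q g) {u : X} (hu : u ≠ o) (k : ℕ) :
    ∑ x ∈ generation G o u k, g x =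
      (q : ℂ) ^ k * (g (parent G o u) + (g u - g (parent G o u)) * (profile q (k + 1) : ℝ)) := by
  rw [isHarmonic_iff] at hg
  have hq' : (q : ℂ) ≠ 0 := by
    have : q ≠ 0 := by omega
    exact_mod_cast this
  have step : ∀ k, ((q : ℂ) + 1) * ∑ x ∈ generation G o u k, g x =
      ∑ x ∈ generation G o u k, g (parent G o x) + ∑ x ∈ generation G o u (k + 1), g x := by
    intro k
    rw [sum_generation_succ hG.1, Finset.mul_sum, ← Finset.sum_add_distrib]
    refine Finset.sum_congr rfl fun x hx => ?_
    rw [hg, sum_neighborFinset hG.1 (ne_origin_of_mem_generation hG.1 hx (Or.inl hu))]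
  have hpar : ∀ k, ∑ x ∈ generation G o u (k + 1), g (parent G o x) =
      q * ∑ x ∈ generation G o u k, g x := by
    intro k
    rw [sum_generation_succ hG.1, Finset.mul_sum]
    refine Finset.sum_congr rfl fun w hw => ?_
    rw [Finset.sum_congr rfl fun x hx => by rw [((mem_children hG.1).1 hx).2], Finset.sum_const,
      card_children hG (ne_origin_of_mem_generation hG.1 hw (Or.inl hu)), nsmul_eq_mul]
  -- Two consecutive generations are carried along because the recurrence has order two.
  have main : ∀ k, ∑ x ∈ generation G o u k, g x =
        (q : ℂ) ^ k * (g (parent G o u) + (g u - g (parent G o u)) * (profile q (k + 1) : ℝ)) ∧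
      ∑ x ∈ generation G o u (k + 1), g x = (q : ℂ) ^ (k + 1) *
        (g (parent G o u) + (g u - g (parent G o u)) * (profile q (k + 2) : ℝ)) := by
    intro k
    induction k with
    | zero =>
      have h0 := step 0
      have e0 : ∑ x ∈ generation G o u 0, g x = g u := by simp [generation]
      have e1 : ∑ x ∈ generation G o u 0, g (parent G o x) = g (parent G o u) := by
        simp [generation]
      rw [e0, e1] at h0
      refine ⟨by rw [e0, profile_one]; simp, ?_⟩
      rw [← sub_eq_iff_eq_add'] at h0
      rw [← h0, show profile q (0 + 2) = 1 + 1 / q by simp [profile]]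
      push_cast
      field_simp
      ring
    | succ k ih =>
      refine ⟨ih.2, ?_⟩
      have h := step (k + 1)
      rw [hpar, ih.1, ih.2, ← sub_eq_iff_eq_add'] at h
      have hr : ((q : ℂ) + 1) * (profile q (k + 2) : ℝ) =
          (profile q (k + 1) : ℝ) + q * (profile q (k + 3) : ℝ) := by
        exact_mod_cast profile_recurrence hq (k + 1)
      rw [← h, show k + 1 + 2 = k + 3 from rfl]
      linear_combination (q : ℂ) ^ (k + 1) * (g u - g (parent G o u)) * hr
  exact (main k).1

end Homogeneous

/-- The base `q ^ (-α)` of the density of `μ_α`. -/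
def decay (q : ℕ) (α : ℝ) : ℝ := (q : ℝ) ^ (-α)

/-! ### The weight and radial functions on sectors -/

section Decay

variable {q : ℕ} {α : ℝ}

theorem decay_pos (hq : 2 ≤ q) : 0 < decay q α :=
  Real.rpow_pos_of_pos (by exact_mod_cast (by omega : 0 < q)) _

theorem mul_decay_pos (hq : 2 ≤ q) : 0 < q * decay q α :=
  mul_pos (by exact_mod_cast (by omega : 0 < q)) (decay_pos hq)

theorem mul_decay_lt_one (hq : 2 ≤ q) (hα : 1 < α) : q * decay q α < 1 := by
  have hq0 : (0 : ℝ) < q := by exact_mod_cast (by omega : 0 < q)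
  have hq1 : (1 : ℝ) < q := by exact_mod_cast (by omega : 1 < q)
  rw [decay]
  nth_rewrite 1 [← Real.rpow_one (q : ℝ)]
  rw [← Real.rpow_add hq0]
  exact Real.rpow_lt_one_of_one_lt_of_neg hq1 (by linarith)

theorem weight_eq (G : SimpleGraph X) (o x : X) : weight G q o α x = decay q α ^ G.dist o x := by
  rw [weight, decay, ← Real.rpow_natCast, ← Real.rpow_mul (Nat.cast_nonneg q), neg_mul]

end Decay

section Radial

variable {G : SimpleGraph X} [G.LocallyFinite] {o : X}

/-- The function on the sector of `u` that takes the value `φ k` in the `k`-th generation. -/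
def radial (G : SimpleGraph X) [G.LocallyFinite] (o : X) (φ : ℕ → ℝ) (u : X) : X → ℝ :=
  (sector G o u).indicator fun x => φ (G.dist o x - G.dist o u)

theorem radial_of_mem_generation (hG : G.IsTree) {φ : ℕ → ℝ} {u x : X} {k : ℕ}
    (hx : x ∈ generation G o u k) : radial G o φ u x = φ k := by
  rw [radial, Set.indicator_of_mem (show x ∈ sector G o u from Set.mem_iUnion.2 ⟨k, hx⟩), ((mem_generation hG).1 hx).1,
    Nat.add_sub_cancel_left]

theorem abs_radial_le {φ : ℕ → ℝ} {B : ℝ} (hB : 0 ≤ B) (hφ : ∀ k, |φ k| ≤ B) (u x : X) :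
    |radial G o φ u x| ≤ B := by
  by_cases hx : x ∈ sector G o u
  · rw [radial, Set.indicator_of_mem hx]
    exact hφ _
  · rw [radial, Set.indicator_of_notMem hx, abs_zero]
    exact hB

end Radial

theorem summable_pow_mul_bounded {r B : ℝ} (h0 : 0 ≤ r) (h1 : r < 1) {φ : ℕ → ℝ}
    (hφ : ∀ k, |φ k| ≤ B) : Summable fun k => r ^ k * φ k := by
  refine Summable.of_norm_bounded ((summable_geometric_of_lt_one h0 h1).mul_right B) fun k => ?_
  rw [norm_mul, Real.norm_eq_abs, Real.norm_eq_abs, abs_of_nonneg (pow_nonneg h0 k)]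
  exact mul_le_mul_of_nonneg_left (hφ k) (pow_nonneg h0 k)

/-! ### Masses of generations and integrals against radial functions -/

section Measure

variable [MeasurableSpace X] [DiscreteMeasurableSpace X] {G : SimpleGraph X}
  {q : ℕ} {o : X} {α : ℝ}

theorem mu_singleton_eq (x : X) :
    mu G q o α {x} = ENNReal.ofReal (decay q α ^ G.dist o x) := by
  rw [mu_singleton, weight_eq]

theorem integrable_mul_of_bounded {k : X → ℝ} {B : ℝ} (hk : ∀ x, |k x| ≤ B) {g : X → ℂ}
    (hg : Integrable g (mu G q o α)) : Integrable (fun x => (k x : ℂ) * g x) (mu G q o α) := by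
  refine hg.bdd_mul (c := B) (Measurable.of_discrete).aestronglyMeasurable ?_
  exact Filter.Eventually.of_forall fun x => by simpa using hk x

variable [G.LocallyFinite]

theorem mu_generation_le (hG : IsHomogeneousTree G q) (hq : 2 ≤ q) (v : X) (k : ℕ) :
    mu G q o α (generation G o v k) ≤
      ENNReal.ofReal (2 * decay q α ^ G.dist o v * (q * decay q α) ^ k) := by
  have hw := decay_pos (α := α) hq
  rw [← sum_measure_singleton]
  calc ∑ x ∈ generation G o v k, mu G q o α {x}
      = ∑ x ∈ generation G o v k, ENNReal.ofReal (decay q α ^ (G.dist o v + k)) := by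
        refine Finset.sum_congr rfl fun x hx => ?_
        rw [mu_singleton_eq, ((mem_generation hG.1).1 hx).1]
    _ = ENNReal.ofReal ((generation G o v k).card * decay q α ^ (G.dist o v + k)) := by
        rw [Finset.sum_const, nsmul_eq_mul, ENNReal.ofReal_mul (by positivity),
          ENNReal.ofReal_natCast]
    _ ≤ _ := by
        refine ENNReal.ofReal_le_ofReal ?_
        have h : ((generation G o v k).card : ℝ) ≤ 2 * (q : ℝ) ^ k := by
          exact_mod_cast card_generation_le hG hq v k
        calc _ ≤ (2 * (q : ℝ) ^ k) * decay q α ^ (G.dist o v + k) := by gcongr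
          _ = _ := by rw [pow_add, mul_pow]; ring

/-- The descendants of `v` in the generations from `j` on carry a mass of order
`q ^ (-α |v|) * q ^ ((1 - α) j)`. -/
theorem mu_iUnion_generation_le (hG : IsHomogeneousTree G q) (hq : 2 ≤ q) (hα : 1 < α) (v : X)
    (j : ℕ) :
    mu G q o α (⋃ k, (generation G o v (j + k) : Set X)) ≤ ENNReal.ofReal
      (2 * (1 - q * decay q α)⁻¹ * (q * decay q α) ^ j * decay q α ^ G.dist o v) := by
  have hw := decay_pos (α := α) hq
  have h0 := mul_decay_pos (α := α) hq
  have h1 := mul_decay_lt_one hq hα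
  have hs := (hasSum_geometric_of_lt_one h0.le h1).mul_left
    (2 * decay q α ^ G.dist o v * (q * decay q α) ^ j)
  calc _ ≤ ∑' k, mu G q o α (generation G o v (j + k)) := measure_iUnion_le _
    _ ≤ ∑' k, ENNReal.ofReal
        (2 * decay q α ^ G.dist o v * (q * decay q α) ^ j * (q * decay q α) ^ k) := by
        refine ENNReal.tsum_le_tsum fun k => ?_
        rw [mul_assoc, ← pow_add]
        exact mu_generation_le hG hq v (j + k)
    _ = _ := by
        rw [← ENNReal.ofReal_tsum_of_nonneg (fun k => by positivity) hs.summable, hs.tsum_eq]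
        congr 1
        ring

theorem isFiniteMeasure_mu (hG : IsHomogeneousTree G q) (hq : 2 ≤ q) (hα : 1 < α) :
    IsFiniteMeasure (mu G q o α) := by
  refine ⟨?_⟩
  have h := mu_iUnion_generation_le (o := o) hG hq hα o 0
  simp only [zero_add] at h
  rw [← sector_origin (o := o) hG.1, sector]
  exact h.trans_lt ENNReal.ofReal_lt_top

/-- Integrating generation by generation, the `q ^ k` of the generation sum and the weight combine
to `(q * decay q α) ^ k`. Only two numbers attached to `g` survive. -/
theorem integral_radial_mul (hG : IsHomogeneousTree G q) (hq : 2 ≤ q) (hα : 1 < α)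
    {φ : ℕ → ℝ} {B : ℝ} (hφ : ∀ k, |φ k| ≤ B) {g : X → ℂ} (hg : IsHarmonic G q g)
    (hgi : Integrable g (mu G q o α)) {u : X} (hu : u ≠ o) :
    ∫ x, (radial G o φ u x : ℂ) * g x ∂(mu G q o α) =
      (decay q α : ℂ) ^ G.dist o u *
        ((∑' k, (q * decay q α) ^ k * φ k : ℝ) * g (parent G o u) +
          (∑' k, (q * decay q α) ^ k * (φ k * profile q (k + 1)) : ℝ) *
            (g u - g (parent G o u))) := by
  have hB : 0 ≤ B := (abs_nonneg _).trans (hφ 0)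
  have h0 := mul_decay_pos (α := α) hq
  have h1 := mul_decay_lt_one hq hα
  have hint := integrable_mul_of_bounded (abs_radial_le (G := G) (o := o) hB hφ u) hgi
  have hS : ∫ x, (radial G o φ u x : ℂ) * g x ∂(mu G q o α) =
      ∫ x in ⋃ k, (generation G o u k : Set X), (radial G o φ u x : ℂ) * g x ∂(mu G q o α) := by
    refine (setIntegral_eq_integral_of_forall_compl_eq_zero fun x hx => ?_).symm
    rw [radial, Set.indicator_of_notMem (show x ∉ sector G o u from hx)]
    simp
  have hsum := hasSum_integral_iUnion (fun k => MeasurableSet.of_discrete)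
    (pairwise_disjoint_generation (o := o) hG.1 u) hint.integrableOn
  rw [← hS] at hsum
  have hterm : ∀ k, ∫ x in (generation G o u k : Set X),
      (radial G o φ u x : ℂ) * g x ∂(mu G q o α) = (decay q α : ℂ) ^ G.dist o u *
        (((q * decay q α) ^ k * φ k : ℝ) * g (parent G o u) +
          ((q * decay q α) ^ k * (φ k * profile q (k + 1)) : ℝ) * (g u - g (parent G o u))) := by
    intro k
    rw [setIntegral_finset _ hint.integrableOn]
    calc _ = ∑ x ∈ generation G o u k, (decay q α : ℂ) ^ (G.dist o u + k) * (φ k : ℂ) * g x := by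
          refine Finset.sum_congr rfl fun x hx => ?_
          rw [radial_of_mem_generation hG.1 hx, Measure.real, mu_singleton_eq,
            ((mem_generation hG.1).1 hx).1,
            ENNReal.toReal_ofReal (pow_nonneg (decay_pos hq).le _), Complex.real_smul]
          push_cast
          ring
      _ = _ := by
          rw [← Finset.mul_sum, hg.sum_generation hG hq hu]
          push_cast
          rw [pow_add, mul_pow]
          ring
  simp only [hterm] at hsum
  have s1 := (summable_pow_mul_bounded h0.le h1 hφ).hasSum
  have s2 := (summable_pow_mul_bounded (φ := fun k => φ k * profile q (k + 1)) (B := B * 2)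
    h0.le h1 fun k => by
      rw [abs_mul, abs_of_nonneg (profile_nonneg _)]
      exact mul_le_mul (hφ k) (profile_le_two hq _) (profile_nonneg _) hB).hasSum
  refine hsum.unique (HasSum.mul_left _ (HasSum.add ?_ ?_))
  · exact (Complex.hasSum_ofReal.2 s1).mul_right _
  · exact (Complex.hasSum_ofReal.2 s2).mul_right _

end Measure

/-! ### Harmonicity of the profile on a sector -/

section Sector

variable {G : SimpleGraph X} [G.LocallyFinite] {o : X}

theorem mem_generation_succ_of_mem_children (hG : G.IsTree) {u x y : X} {k : ℕ}
    (hx : x ∈ generation G o u k) (hy : y ∈ children G o x) : y ∈ generation G o u (k + 1) := by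
  rw [mem_generation hG] at hx ⊢
  rw [mem_children hG] at hy
  rw [Function.iterate_succ_apply, hy.2]
  exact ⟨by omega, hx.2⟩

theorem parent_mem_generation (hG : G.IsTree) {u x : X} {k : ℕ}
    (hx : x ∈ generation G o u (k + 1)) : parent G o x ∈ generation G o u k := by
  rw [mem_generation hG] at hx ⊢
  rw [Function.iterate_succ_apply] at hx
  rw [dist_parent hG]
  exact ⟨by omega, hx.2⟩

theorem sector_subset_sector_parent (hG : G.IsTree) {u : X} (hu : u ≠ o) :
    sector G o u ⊆ sector G o (parent G o u) := by
  intro x hx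
  obtain ⟨k, h1, h2⟩ := (mem_sector hG).1 hx
  refine (mem_sector hG).2 ⟨k + 1, ?_, ?_⟩
  · have := (parent_spec hG hu).2
    omega
  · rw [Function.iterate_succ_apply', h2]

theorem parent_notMem_sector (hG : G.IsTree) {u : X} (hu : u ≠ o) :
    parent G o u ∉ sector G o u := by
  intro h
  obtain ⟨k, h1, -⟩ := (mem_sector hG).1 h
  have := (parent_spec hG hu).2
  omega

theorem parent_mem_sector (hG : G.IsTree) {u x : X} (hx : x ∈ sector G o u) (hxu : x ≠ u) :
    parent G o x ∈ sector G o u := by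
  obtain ⟨k, hk⟩ := Set.mem_iUnion.1 hx
  cases k with
  | zero => exact absurd (Finset.mem_singleton.1 hk) hxu
  | succ k => exact Set.mem_iUnion.2 ⟨k, parent_mem_generation hG hk⟩

theorem ne_origin_of_mem_children (hG : G.IsTree) {v x : X} (hx : x ∈ children G o v) :
    x ≠ o := by
  rintro rfl
  have := ((mem_children hG).1 hx).1
  simp at this

theorem mem_children_parent (hG : G.IsTree) {u : X} (hu : u ≠ o) :
    u ∈ children G o (parent G o u) :=
  (mem_children hG).2 ⟨(parent_spec hG hu).2, rfl⟩

theorem radial_of_notMem {φ : ℕ → ℝ} {u x : X} (hx : x ∉ sector G o u) :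
    radial G o φ u x = 0 :=
  Set.indicator_of_notMem hx _

open Classical in
/-- The radial function with values `profile q (k + 1)` on the sector of `u` is harmonic away from
the parent of `u`. -/
theorem sum_neighborFinset_radial {q : ℕ} (hG : IsHomogeneousTree G q) (hq : 2 ≤ q) {u : X}
    (hu : u ≠ o) (y : X) :
    ∑ x ∈ G.neighborFinset y, radial G o (fun k => profile q (k + 1)) u x =
      ((q : ℝ) + 1) * radial G o (fun k => profile q (k + 1)) u y +
        if y = parent G o u then 1 else 0 := by
  by_cases hy : y ∈ sector G o u
  · have hyp : y ≠ parent G o u := by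
      rintro rfl
      exact parent_notMem_sector hG.1 hu hy
    obtain ⟨k, hk⟩ := Set.mem_iUnion.1 hy
    have hyo : y ≠ o := ne_origin_of_mem_generation hG.1 hk (Or.inl hu)
    -- At `y = u` the parent lies outside the sector, which agrees with `profile q 0 = 0`.
    have hp : radial G o (fun k => profile q (k + 1)) u (parent G o y) = profile q k := by
      cases k with
      | zero =>
        rw [show y = u from Finset.mem_singleton.1 hk,
          radial_of_notMem (parent_notMem_sector hG.1 hu)]
        rfl
      | succ k => rw [radial_of_mem_generation hG.1 (parent_mem_generation hG.1 hk)]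
    rw [if_neg hyp, add_zero, sum_neighborFinset hG.1 hyo, hp, radial_of_mem_generation hG.1 hk,
      profile_recurrence hq, Finset.sum_congr rfl fun x hx =>
        radial_of_mem_generation hG.1 (mem_generation_succ_of_mem_children hG.1 hk hx),
      Finset.sum_const, card_children hG hyo, nsmul_eq_mul]
  -- The only edge entering the sector from outside joins the parent of `u` to `u`.
  · have hz : ∀ x ∈ G.neighborFinset y, ¬(x = u ∧ y = parent G o u) →
        radial G o (fun k => profile q (k + 1)) u x = 0 := by
      intro x hx hne
      refine radial_of_notMem fun hxs => ?_
      rw [SimpleGraph.mem_neighborFinset] at hx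
      rcases hG.1.dist_eq_dist_add_one_of_adj o hx with h | h
      · obtain ⟨k, hk⟩ := Set.mem_iUnion.1 hxs
        have hyx : y ∈ children G o x :=
          (mem_children hG.1).2 ⟨h, (eq_parent_iff hG.1 h).2 hx⟩
        exact hy (Set.mem_iUnion.2 ⟨k + 1, mem_generation_succ_of_mem_children hG.1 hk hyx⟩)
      · have hpx : parent G o x = y := (eq_parent_iff hG.1 h).2 hx.symm
        by_cases hxu : x = u
        · exact hne ⟨hxu, by rw [← hpx, hxu]⟩
        · exact hy (hpx ▸ parent_mem_sector hG.1 hxs hxu)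
    rw [radial_of_notMem hy, mul_zero, zero_add]
    split_ifs with hyu
    · have hu' : u ∈ G.neighborFinset y := by
        rw [hyu, SimpleGraph.mem_neighborFinset]
        exact (parent_spec hG.1 hu).1.symm
      rw [Finset.sum_eq_single_of_mem u hu' fun x hx hxu => hz x hx fun h => hxu h.1,
        radial_of_mem_generation hG.1 (k := 0) (by simp [generation]), profile_one]
    · exact Finset.sum_eq_zero fun x hx => hz x hx fun h => hyu h.2

end Sector

/-! ### Kernels representing functionals on harmonic functions -/

section Kernel

variable [MeasurableSpace X] {G : SimpleGraph X} [G.LocallyFinite] {q : ℕ} {o : X} {α : ℝ}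

/-- The bounded real harmonic function `k` represents the functional `L` on the integrable harmonic
functions. -/
structure Represents (G : SimpleGraph X) [G.LocallyFinite] (q : ℕ) (o : X) (α : ℝ) (k : X → ℝ)
    (L : (X → ℂ) → ℂ) : Prop where
  harmonic : ∀ v, ((q : ℝ) + 1) * k v = ∑ u ∈ G.neighborFinset v, k u
  bounded : ∃ B, ∀ x, |k x| ≤ B
  integral : ∀ g, IsHarmonic G q g → Integrable g (mu G q o α) →
    ∫ x, (k x : ℂ) * g x ∂(mu G q o α) = L g

theorem Represents.congr {k : X → ℝ} {L L' : (X → ℂ) → ℂ} (h : Represents G q o α k L)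
    (hL : ∀ g, IsHarmonic G q g → L g = L' g) : Represents G q o α k L' :=
  ⟨h.harmonic, h.bounded, fun g hg hgi => (h.integral g hg hgi).trans (hL g hg)⟩

theorem Represents.const_mul {k : X → ℝ} {L : (X → ℂ) → ℂ} (h : Represents G q o α k L) (c : ℝ) :
    Represents G q o α (fun x => c * k x) (fun g => c * L g) := by
  refine ⟨fun v => ?_, ?_, fun g hg hgi => ?_⟩
  · rw [← Finset.mul_sum, ← h.harmonic v]
    ring
  · obtain ⟨B, hB⟩ := h.bounded
    refine ⟨|c| * B, fun x => ?_⟩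
    rw [abs_mul]
    exact mul_le_mul_of_nonneg_left (hB x) (abs_nonneg c)
  · simp only [Complex.ofReal_mul, mul_assoc]
    rw [integral_const_mul, h.integral g hg hgi]

variable [DiscreteMeasurableSpace X]

theorem Represents.add {k l : X → ℝ} {L M : (X → ℂ) → ℂ} (h : Represents G q o α k L)
    (h' : Represents G q o α l M) :
    Represents G q o α (fun x => k x + l x) (fun g => L g + M g) := by
  obtain ⟨B, hB⟩ := h.bounded
  obtain ⟨C, hC⟩ := h'.bounded
  refine ⟨fun v => ?_, ⟨B + C, fun x => ?_⟩, fun g hg hgi => ?_⟩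
  · rw [Finset.sum_add_distrib, ← h.harmonic v, ← h'.harmonic v]
    ring
  · exact (abs_add_le _ _).trans (add_le_add (hB x) (hC x))
  · simp only [Complex.ofReal_add, add_mul]
    rw [integral_add (integrable_mul_of_bounded hB hgi) (integrable_mul_of_bounded hC hgi),
      h.integral g hg hgi, h'.integral g hg hgi]

-- Away from `o` this rearranges harmonicity at `v`. At `o` the right side vanishes because `o` is
-- its own parent, so no separate formula is needed.
omit [MeasurableSpace X] [DiscreteMeasurableSpace X] in
theorem IsHarmonic.average_children (hG : IsHomogeneousTree G q) (hq : 2 ≤ q) {g : X → ℂ}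
    (hg : IsHarmonic G q g) (v : X) :
    ((children G o v).card : ℂ)⁻¹ * ∑ u ∈ children G o v, (g u - g v) =
      (q : ℂ)⁻¹ * (g v - g (parent G o v)) := by
  rw [isHarmonic_iff] at hg
  have hq' : (q : ℂ) ≠ 0 := by exact_mod_cast (by omega : q ≠ 0)
  rw [Finset.sum_sub_distrib, Finset.sum_const, nsmul_eq_mul]
  by_cases hv : v = o
  · rw [hv, parent_self, card_children_origin hG, children_origin, ← hg]
    push_cast
    ring
  · have h := hg v
    rw [sum_neighborFinset hG.1 hv, ← sub_eq_iff_eq_add'] at h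
    rw [card_children hG hv, ← h]
    ring

end Kernel

/-! ### Sibling kernels and the reproducing kernel -/

section Kernel

variable {G : SimpleGraph X} [G.LocallyFinite] {q : ℕ} {o : X} {α : ℝ}

/-- The harmonic function on the sector of `u` with values `profile q (k + 1)`. -/
def sectorProfile (G : SimpleGraph X) [G.LocallyFinite] (q : ℕ) (o u : X) : X → ℝ :=
  radial G o (fun k => profile q (k + 1)) u

/-- The square norm of `sectorProfile G q o u`, up to the factor `q ^ (-α |u|)`. -/
def profileNormSq (q : ℕ) (α : ℝ) : ℝ :=
  ∑' k, (q * decay q α) ^ k * (profile q (k + 1) * profile q (k + 1))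

theorem one_le_profileNormSq (hq : 2 ≤ q) (hα : 1 < α) : 1 ≤ profileNormSq q α := by
  have h0 := mul_decay_pos (α := α) hq
  have hs : Summable fun k => (q * decay q α) ^ k * (profile q (k + 1) * profile q (k + 1)) :=
    summable_pow_mul_bounded (B := 2 * 2) h0.le (mul_decay_lt_one hq hα) fun k => by
      rw [abs_of_nonneg (mul_self_nonneg _)]
      exact mul_self_le_mul_self (profile_nonneg _) (profile_le_two hq _)
  have h := hs.le_tsum 0 fun k _ => mul_nonneg (pow_nonneg h0.le k) (mul_self_nonneg _)
  simpa [profileNormSq, profile_one] using h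

/-- The harmonic function supported below the parent of `u` that compares the sector of `u` with
the average over the sectors of its siblings. -/
def siblingKernel (G : SimpleGraph X) [G.LocallyFinite] (q : ℕ) (o : X) (α : ℝ) (u x : X) : ℝ :=
  (profileNormSq q α * decay q α ^ G.dist o u)⁻¹ *
    (sectorProfile G q o u x - ((children G o (parent G o u)).card : ℝ)⁻¹ *
      ∑ v ∈ children G o (parent G o u), sectorProfile G q o v x)

theorem card_children_parent_ne_zero (hG : G.IsTree) {u : X} (hu : u ≠ o) :
    (children G o (parent G o u)).card ≠ 0 :=
  Finset.card_ne_zero_of_mem (mem_children_parent hG hu)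

theorem abs_sectorProfile_le (hq : 2 ≤ q) (u x : X) : |sectorProfile G q o u x| ≤ 2 :=
  abs_radial_le zero_le_two
    (fun k => by
      rw [abs_of_nonneg (profile_nonneg _)]
      exact profile_le_two hq _) u x

/-- Each sibling's profile has the same defect 1 at the common parent and none elsewhere, so
subtracting the average cancels it. -/
theorem siblingKernel_harmonic (hG : IsHomogeneousTree G q) (hq : 2 ≤ q) {u : X} (hu : u ≠ o)
    (v : X) : ((q : ℝ) + 1) * siblingKernel G q o α u v =
      ∑ x ∈ G.neighborFinset v, siblingKernel G q o α u x := by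
  classical
  have hc : ((children G o (parent G o u)).card : ℝ) ≠ 0 := by
    exact_mod_cast card_children_parent_ne_zero hG.1 hu
  have h1 : ∑ x ∈ G.neighborFinset v, ∑ y ∈ children G o (parent G o u), sectorProfile G q o y x =
      ((q : ℝ) + 1) * (∑ y ∈ children G o (parent G o u), sectorProfile G q o y v) +
        ((children G o (parent G o u)).card : ℝ) * if v = parent G o u then 1 else 0 := by
    rw [Finset.sum_comm, Finset.mul_sum, ← nsmul_eq_mul, ← Finset.sum_const,
      ← Finset.sum_add_distrib]
    refine Finset.sum_congr rfl fun y hy => ?_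
    rw [sectorProfile, sum_neighborFinset_radial hG hq (ne_origin_of_mem_children hG.1 hy),
      ((mem_children hG.1).1 hy).2]
  have h2 := sum_neighborFinset_radial hG hq hu v
  simp only [siblingKernel]
  rw [← Finset.mul_sum, Finset.sum_sub_distrib, ← Finset.mul_sum, h1]
  rw [← sectorProfile] at h2
  rw [h2, mul_add, inv_mul_cancel_left₀ hc]
  ring

theorem abs_siblingKernel_le (hG : IsHomogeneousTree G q) (hq : 2 ≤ q) (hα : 1 < α) {u : X}
    (hu : u ≠ o) (x : X) : |siblingKernel G q o α u x| ≤
      4 * (decay q α)⁻¹ * ((decay q α)⁻¹ ^ G.dist o (parent G o u) *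
        (sector G o (parent G o u)).indicator 1 x) := by
  have hw := decay_pos (α := α) hq
  have hN := one_le_profileNormSq hq hα
  have hc : ((children G o (parent G o u)).card : ℝ) ≠ 0 := by
    exact_mod_cast card_children_parent_ne_zero hG.1 hu
  by_cases hx : x ∈ sector G o (parent G o u)
  · rw [Set.indicator_of_mem hx, Pi.one_apply, mul_one, siblingKernel, abs_mul]
    -- `profileNormSq q α ≥ 1` can be dropped; passing from `u` to its parent costs one factor
    -- `(decay q α)⁻¹`.
    have h1 : |(profileNormSq q α * decay q α ^ G.dist o u)⁻¹| ≤
        (decay q α)⁻¹ * (decay q α)⁻¹ ^ G.dist o (parent G o u) := by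
      rw [abs_of_nonneg (by positivity), ← pow_succ', ← (parent_spec hG.1 hu).2, inv_pow]
      refine inv_anti₀ (by positivity) ?_
      exact le_mul_of_one_le_left (by positivity) hN
    have h2 : |sectorProfile G q o u x - ((children G o (parent G o u)).card : ℝ)⁻¹ *
        ∑ v ∈ children G o (parent G o u), sectorProfile G q o v x| ≤ 4 := by
      have h3 : |∑ v ∈ children G o (parent G o u), sectorProfile G q o v x| ≤
          (children G o (parent G o u)).card * 2 := by
        refine (Finset.abs_sum_le_sum_abs _ _).trans ?_
        rw [← nsmul_eq_mul]
        exact Finset.sum_le_card_nsmul _ _ _ fun v _ => abs_sectorProfile_le hq v x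
      have h4 : |((children G o (parent G o u)).card : ℝ)⁻¹ *
          ∑ v ∈ children G o (parent G o u), sectorProfile G q o v x| ≤ 2 := by
        rw [abs_mul, abs_of_nonneg (by positivity)]
        calc _ ≤ ((children G o (parent G o u)).card : ℝ)⁻¹ *
              ((children G o (parent G o u)).card * 2) := by gcongr
          _ = 2 := inv_mul_cancel_left₀ hc 2
      have h5 := abs_sectorProfile_le (G := G) (o := o) hq u x
      exact (abs_sub _ _).trans (by linarith)
    calc _ ≤ ((decay q α)⁻¹ * (decay q α)⁻¹ ^ G.dist o (parent G o u)) * 4 := by gcongr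
      _ = _ := by ring
  · have h : ∀ v ∈ children G o (parent G o u), sectorProfile G q o v x = 0 := by
      intro v hv
      refine radial_of_notMem fun h => hx ?_
      rw [← ((mem_children hG.1).1 hv).2]
      exact sector_subset_sector_parent hG.1 (ne_origin_of_mem_children hG.1 hv) h
    rw [siblingKernel, h u (mem_children_parent hG.1 hu), Finset.sum_eq_zero h,
      Set.indicator_of_notMem hx]
    simp

variable [MeasurableSpace X] [DiscreteMeasurableSpace X]

/-- Subtracting the sibling average removes the contribution of the parent's value, and
`IsHarmonic.average_children` evaluates the averaged increments. -/
theorem represents_siblingKernel (hG : IsHomogeneousTree G q) (hq : 2 ≤ q) (hα : 1 < α) {u : X}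
    (hu : u ≠ o) : Represents G q o α (siblingKernel G q o α u) fun g =>
      (g u - g (parent G o u)) +
        (-(q : ℝ)⁻¹ : ℝ) * (g (parent G o u) - g (parent G o (parent G o u))) := by
  refine ⟨siblingKernel_harmonic hG hq hu, ⟨4 * (decay q α)⁻¹ * ((decay q α)⁻¹ ^
    G.dist o (parent G o u) * 1), fun x => (abs_siblingKernel_le hG hq hα hu x).trans ?_⟩, ?_⟩
  · have hw := decay_pos (α := α) hq
    gcongr
    exact Set.indicator_le_self' (fun _ _ => zero_le_one) x
  intro g hg hgi
  have hw : (decay q α : ℂ) ≠ 0 := by exact_mod_cast (decay_pos hq).ne'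
  have hN : (profileNormSq q α : ℂ) ≠ 0 := by
    exact_mod_cast (zero_lt_one.trans_le (one_le_profileNormSq hq hα)).ne'
  have hc : ((children G o (parent G o u)).card : ℂ) ≠ 0 := by
    exact_mod_cast card_children_parent_ne_zero hG.1 hu
  have hint : ∀ v, Integrable (fun x => (sectorProfile G q o v x : ℂ) * g x) (mu G q o α) :=
    fun v => integrable_mul_of_bounded (abs_sectorProfile_le hq v) hgi
  -- The constant `c` depends only on the common parent, hence is the same for all siblings.
  obtain ⟨c, hI⟩ : ∃ c : ℂ, ∀ v ∈ children G o (parent G o u),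
      ∫ x, (sectorProfile G q o v x : ℂ) * g x ∂(mu G q o α) = (decay q α : ℂ) ^ G.dist o u *
        (c + profileNormSq q α * (g v - g (parent G o u))) := by
    refine ⟨(∑' k, (q * decay q α) ^ k * profile q (k + 1) : ℝ) * g (parent G o u),
      fun v hv => ?_⟩
    have hv' := (mem_children hG.1).1 hv
    have h := integral_radial_mul hG hq hα (φ := fun k => profile q (k + 1)) (B := 2)
      (fun k => by
        rw [abs_of_nonneg (profile_nonneg _)]
        exact profile_le_two hq _) hg hgi (ne_origin_of_mem_children hG.1 hv)
    rw [hv'.2, hv'.1, ← (parent_spec hG.1 hu).2] at h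
    exact h
  have hsplit : ∀ x, (siblingKernel G q o α u x : ℂ) * g x =
      ((profileNormSq q α : ℂ) * (decay q α : ℂ) ^ G.dist o u)⁻¹ *
        ((sectorProfile G q o u x : ℂ) * g x - ((children G o (parent G o u)).card : ℂ)⁻¹ *
          ∑ v ∈ children G o (parent G o u), (sectorProfile G q o v x : ℂ) * g x) := by
    intro x
    rw [siblingKernel, ← Finset.sum_mul]
    push_cast
    ring
  simp only [hsplit]
  rw [integral_const_mul, integral_sub (hint u)
    ((integrable_finsetSum _ fun v _ => hint v).const_mul _), integral_const_mul,
    integral_finsetSum _ fun v _ => hint v, hI u (mem_children_parent hG.1 hu),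
    Finset.sum_congr rfl hI, ← Finset.mul_sum, Finset.sum_add_distrib, Finset.sum_const,
    ← Finset.mul_sum, nsmul_eq_mul]
  have havg := hg.average_children hG hq (o := o) (parent G o u)
  push_cast
  rw [neg_mul, ← havg]
  field_simp
  ring

/-- The sum over the ancestors `v` of `z` of `q ^ (α |v|)` times the indicator of the sector
of `v`. -/
def ancestorSum (G : SimpleGraph X) [G.LocallyFinite] (q : ℕ) (o : X) (α : ℝ) (z x : X) : ℝ :=
  ∑ j ∈ Finset.range (G.dist o z + 1), (decay q α)⁻¹ ^ G.dist o ((parent G o)^[j] z) *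
    (sector G o ((parent G o)^[j] z)).indicator 1 x

omit [MeasurableSpace X] [DiscreteMeasurableSpace X] in
theorem ancestorSum_of_ne (hG : G.IsTree) {z : X} (hz : z ≠ o) (x : X) :
    ancestorSum G q o α z x = ancestorSum G q o α (parent G o z) x +
      (decay q α)⁻¹ ^ G.dist o z * (sector G o z).indicator 1 x := by
  rw [ancestorSum, Finset.sum_range_succ', ancestorSum, ← (parent_spec hG hz).2]
  rfl

omit [MeasurableSpace X] [DiscreteMeasurableSpace X] in
theorem sum_children_origin_radial_one (hG : G.IsTree) {x : X} (hx : x ≠ o) :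
    ∑ u ∈ children G o o, radial G o (fun _ => 1) u x = 1 := by
  have hx0 : G.dist o x ≠ 0 := fun h => hx ((dist_eq_zero_iff_eq hG).1 h)
  have hgen := mem_generation_iterate (o := o) hG (x := x) (k := G.dist o x - 1) (by omega)
  have hd := dist_iterate_parent (o := o) hG x (G.dist o x - 1)
  have hu : (parent G o)^[G.dist o x - 1] x ∈ children G o o := by
    refine (mem_children hG).2 ⟨by rw [hd, G.dist_self]; omega, ?_⟩
    rw [← dist_eq_zero_iff_eq hG, dist_parent hG, hd]
    omega
  rw [Finset.sum_eq_single_of_mem _ hu, radial_of_mem_generation hG hgen]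
  intro v hv hne
  refine radial_of_notMem fun h => hne ?_
  obtain ⟨k, hk, rfl⟩ := (mem_sector hG).1 h
  have h1 := ((mem_children hG).1 hv).1
  rw [G.dist_self] at h1
  rw [show k = G.dist o x - 1 by omega]

/-- The space splits into `o` and the sectors of its neighbours. The increments `g u - g o` sum to
zero by harmonicity at `o`, so only a multiple of `g o` remains. -/
theorem IsHarmonic.integral_eq (hG : IsHomogeneousTree G q) (hq : 2 ≤ q) (hα : 1 < α)
    {g : X → ℂ} (hg : IsHarmonic G q g) (hgi : Integrable g (mu G q o α)) :
    ∫ x, g x ∂(mu G q o α) =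
      (1 + (q + 1) * decay q α * ∑' k, (q * decay q α) ^ k : ℝ) * g o := by
  have hint : ∀ u, Integrable (fun x => (radial G o (fun _ => 1) u x : ℂ) * g x) (mu G q o α) :=
    fun u => integrable_mul_of_bounded
      (abs_radial_le zero_le_one (fun _ => (abs_one (α := ℝ)).le) u) hgi
  have hsplit : ∀ x, g x = ({o} : Set X).indicator g x +
      ∑ u ∈ children G o o, (radial G o (fun _ => 1) u x : ℂ) * g x := by
    intro x
    rw [← Finset.sum_mul, ← Complex.ofReal_sum]
    by_cases hx : x = o
    · rw [Finset.sum_eq_zero, Set.indicator_of_mem (Set.mem_singleton_iff.2 hx)]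
      · simp
      · intro u hu
        refine radial_of_notMem fun h => ?_
        obtain ⟨k, hk, -⟩ := (mem_sector hG.1).1 h
        have := ((mem_children hG.1).1 hu).1
        rw [hx, G.dist_self] at hk
        omega
    · rw [sum_children_origin_radial_one hG.1 hx, Set.indicator_of_notMem (by simpa using hx)]
      simp
  have hI : ∀ u ∈ children G o o, ∫ x, (radial G o (fun _ => 1) u x : ℂ) * g x ∂(mu G q o α) =
      (decay q α : ℂ) * ((∑' k, (q * decay q α) ^ k : ℝ) * g o +
        (∑' k, (q * decay q α) ^ k * profile q (k + 1) : ℝ) * (g u - g o)) := by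
    intro u hu
    have h := integral_radial_mul hG hq hα (φ := fun _ => 1) (B := 1)
      (fun _ => (abs_one (α := ℝ)).le) hg hgi (ne_origin_of_mem_children hG.1 hu)
    have hu' := (mem_children hG.1).1 hu
    simpa [hu'.1, hu'.2] using h
  have havg := hg.average_children hG hq (o := o) o
  have hc : ((children G o o).card : ℂ) ≠ 0 := by
    rw [card_children_origin hG]
    exact_mod_cast q.succ_ne_zero
  rw [parent_self, sub_self, mul_zero, mul_eq_zero, or_iff_right (inv_ne_zero hc)] at havg
  have ho : ∫ x, ({o} : Set X).indicator g x ∂(mu G q o α) = g o := by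
    rw [integral_indicator MeasurableSet.of_discrete, integral_singleton, Measure.real,
      mu_singleton_eq]
    simp
  rw [integral_congr_ae (Filter.Eventually.of_forall hsplit), integral_add
    (hgi.indicator MeasurableSet.of_discrete) (integrable_finsetSum _ fun u _ => hint u), ho,
    integral_finsetSum _ fun u _ => hint u, Finset.sum_congr rfl hI, ← Finset.mul_sum,
    Finset.sum_add_distrib, ← Finset.mul_sum, ← Finset.mul_sum, havg, Finset.sum_const, card_children_origin hG,
    nsmul_eq_mul]
  push_cast
  ring

theorem exists_represents_origin (hG : IsHomogeneousTree G q) (hq : 2 ≤ q) (hα : 1 < α) :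
    ∃ c : ℝ, Represents G q o α (fun _ => c) fun g => g o := by
  have hM : 0 < 1 + (q + 1) * decay q α * ∑' k, (q * decay q α) ^ k := by
    have hw := decay_pos (α := α) hq
    have : 0 ≤ ∑' k, (q * decay q α) ^ k :=
      tsum_nonneg fun k => pow_nonneg (mul_decay_pos (α := α) hq).le k
    positivity
  refine ⟨(1 + (q + 1) * decay q α * ∑' k, (q * decay q α) ^ k)⁻¹, fun v => ?_, ⟨_, fun _ => le_rfl⟩,
    fun g hg hgi => ?_⟩
  · have h : (G.neighborFinset v).card = q + 1 := hG.2 v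
    rw [Finset.sum_const, h, nsmul_eq_mul]
    push_cast
    rfl
  · rw [integral_const_mul, hg.integral_eq hG hq hα hgi, ← mul_assoc, ← Complex.ofReal_mul,
      inv_mul_cancel₀ hM.ne', Complex.ofReal_one, one_mul]

/-- With `d` representing the increment at the parent, the increment at `z` is represented by the
sibling kernel plus `d / q`. Adding this to the parent's kernel gives the kernel of `z`. -/
theorem exists_kernel (hG : IsHomogeneousTree G q) (hq : 2 ≤ q) (hα : 1 < α) :
    ∃ (C : ℝ) (K : X → X → ℝ), 0 ≤ C ∧ ∀ z, Represents G q o α (K z) (fun g => g z) ∧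
      ∀ x, |K z x| ≤ C * ancestorSum G q o α z x := by
  have hw := decay_pos (α := α) hq
  have hq' : (2 : ℝ) ≤ q := by exact_mod_cast hq
  obtain ⟨c, hc⟩ := exists_represents_origin (o := o) hG hq hα
  set C := max |c| (8 * (decay q α)⁻¹) with hC
  have hC0 : 0 ≤ C := (abs_nonneg c).trans (le_max_left _ _)
  -- The spare term with factor `C` leaves room for the next step: twice the sibling kernel of a
  -- child of `z` is at most `8 * (decay q α)⁻¹` times the term of `z`, while `2 * q⁻¹ * |d| ≤ |d|`.
  suffices h : ∀ n z, G.dist o z = n → ∃ k d : X → ℝ, Represents G q o α k (fun g => g z) ∧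
      Represents G q o α d (fun g => g z - g (parent G o z)) ∧
      ∀ x, |k x| + |d x| + C * ((decay q α)⁻¹ ^ G.dist o z * (sector G o z).indicator 1 x) ≤
        2 * C * ancestorSum G q o α z x by
    choose! K D hK hD hKD using fun z => h _ z rfl
    refine ⟨2 * C, K, by positivity, fun z => ⟨hK z, fun x => le_trans ?_ (hKD z x)⟩⟩
    have := mul_nonneg hC0 (mul_nonneg (pow_nonneg (inv_nonneg.2 hw.le) (G.dist o z))
      (Set.indicator_nonneg (s := sector G o z) (f := (1 : X → ℝ)) (fun _ _ => zero_le_one) x))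
    linarith [abs_nonneg (D z x)]
  intro n
  induction n with
  | zero =>
    intro z hz
    obtain rfl := (dist_eq_zero_iff_eq hG.1).1 hz
    -- The increment at the origin is zero, so the zero kernel represents it.
    refine ⟨_, _, hc, (hc.const_mul 0).congr fun g _ => ?_, fun x => ?_⟩
    · rw [parent_self]
      simp
    · have h1 : ancestorSum G q z α z x = 1 := by
        simp [ancestorSum, sector_origin hG.1]
      rw [h1, zero_mul, abs_zero, sector_origin hG.1, G.dist_self]
      simp only [Set.mem_univ, Set.indicator_of_mem, Pi.one_apply]
      linarith [le_max_left |c| (8 * (decay q α)⁻¹)]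
  | succ n ih =>
    intro z hz
    have hzo : z ≠ o := by
      rintro rfl
      simp at hz
    obtain ⟨k, d, hk, hd, hkd⟩ := ih (parent G o z) (by rw [dist_parent hG.1]; omega)
    have hD := (represents_siblingKernel hG hq hα hzo).add (hd.const_mul (q : ℝ)⁻¹)
    have hD' : Represents G q o α (fun x => siblingKernel G q o α z x + (q : ℝ)⁻¹ * d x)
        fun g => g z - g (parent G o z) := hD.congr fun g _ => by push_cast; ring
    refine ⟨_, _, (hk.add hD').congr fun g _ => by ring, hD', fun x => ?_⟩
    have he := abs_siblingKernel_le hG hq hα hzo x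
    have h1 : |siblingKernel G q o α z x + (q : ℝ)⁻¹ * d x| ≤
        |siblingKernel G q o α z x| + 2⁻¹ * |d x| := by
      refine (abs_add_le _ _).trans ?_
      rw [abs_mul, abs_of_nonneg (by positivity : (0 : ℝ) ≤ (q : ℝ)⁻¹)]
      gcongr
    have h2 := abs_add_le (k x) (siblingKernel G q o α z x + (q : ℝ)⁻¹ * d x)
    have h3 := hkd x
    have hv := mul_nonneg (pow_nonneg (inv_nonneg.2 hw.le) (G.dist o (parent G o z)))
      (Set.indicator_nonneg (s := sector G o (parent G o z)) (f := (1 : X → ℝ))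
        (fun _ _ => zero_le_one) x)
    have hz' := mul_nonneg (pow_nonneg (inv_nonneg.2 hw.le) (G.dist o z))
      (Set.indicator_nonneg (s := sector G o z) (f := (1 : X → ℝ)) (fun _ _ => zero_le_one) x)
    have h4 := mul_le_mul_of_nonneg_right (le_max_right |c| (8 * (decay q α)⁻¹)) hv
    have h5 := mul_nonneg hC0 hz'
    rw [ancestorSum_of_ne hG.1 hzo]
    linarith

end Kernel

/-! ### The weak type estimate for the ancestor sum -/

section WeakType

variable [MeasurableSpace X] [DiscreteMeasurableSpace X] {G : SimpleGraph X} [G.LocallyFinite]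
  {q : ℕ} {o : X} {α : ℝ}

omit [MeasurableSpace X] [DiscreteMeasurableSpace X] in
/-- The minimal vertices, with respect to the order in which ancestors are smaller, of a set of
vertices have disjoint sectors. -/
theorem disjoint_sector_of_minimal (hG : G.IsTree) {P : X → Prop} {v w : X}
    (hv : P v ∧ ∀ i, 0 < i → i ≤ G.dist o v → ¬P ((parent G o)^[i] v))
    (hw : P w ∧ ∀ i, 0 < i → i ≤ G.dist o w → ¬P ((parent G o)^[i] w)) (hne : v ≠ w) :
    Disjoint (sector G o v) (sector G o w) := by
  have key : ∀ {v w x : X} {i j : ℕ}, P w →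
      (∀ i, 0 < i → i ≤ G.dist o v → ¬P ((parent G o)^[i] v)) →
      G.dist o x = G.dist o v + i → (parent G o)^[i] x = v →
      G.dist o x = G.dist o w + j → (parent G o)^[j] x = w → i ≤ j → v = w := by
    intro v w x i j hw hv h1 h2 h3 h4 hij
    obtain ⟨k, rfl⟩ := Nat.exists_eq_add_of_le' hij
    rw [Function.iterate_add_apply, h2] at h4
    rcases Nat.eq_zero_or_pos k with rfl | hk
    · exact h4
    · exact absurd (h4 ▸ hw) (hv k hk (by omega))
  refine Set.disjoint_left.2 fun x hxv hxw => hne ?_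
  obtain ⟨i, h1, h2⟩ := (mem_sector hG).1 hxv
  obtain ⟨j, h3, h4⟩ := (mem_sector hG).1 hxw
  rcases le_total i j with hij | hij
  · exact key hw.1 hv.2 h1 h2 h3 h4 hij
  · exact (key hv.1 hw.2 h3 h4 h1 h2 hij).symm

/-- The vertices whose `j`-th ancestor `v` has a sector of `ν`-mass more than `s * q ^ (-α |v|)`
form a set of measure at most a constant times `q ^ ((1 - α) j) * ν(X) / s`. -/
theorem mu_heavy_le (hG : IsHomogeneousTree G q) (hq : 2 ≤ q) (hα : 1 < α) (ν : Measure X)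
    [IsFiniteMeasure ν] {s : ℝ} (hs : 0 < s) (j : ℕ) :
    mu G q o α {z | j ≤ G.dist o z ∧ s * decay q α ^ G.dist o ((parent G o)^[j] z) <
      ν.real (sector G o ((parent G o)^[j] z))} ≤
      ENNReal.ofReal (2 * (1 - q * decay q α)⁻¹ * (q * decay q α) ^ j * s⁻¹) * ν Set.univ := by
  classical
  have hw := decay_pos (α := α) hq
  have h0 := mul_decay_pos (α := α) hq
  have h1 := sub_pos.2 (mul_decay_lt_one hq hα)
  have := countable_of_isTree hG.1 o
  set P : X → Prop := fun v => s * decay q α ^ G.dist o v < ν.real (sector G o v) with hP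
  set V : Set X := {v | P v ∧ ∀ i, 0 < i → i ≤ G.dist o v → ¬P ((parent G o)^[i] v)} with hV
  have hsub : {z | j ≤ G.dist o z ∧ P ((parent G o)^[j] z)} ⊆
      ⋃ v : V, ⋃ k, (generation G o (v : X) (j + k) : Set X) := by
    rintro z ⟨hj, hz⟩
    -- The heavy ancestor of `z` closest to `o` is minimal, and `z` lies at least `j` generations
    -- below it.
    set i := Nat.findGreatest (fun i => P ((parent G o)^[i] z)) (G.dist o z) with hi
    have hji : j ≤ i := Nat.le_findGreatest hj hz
    have hPi : P ((parent G o)^[i] z) :=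
      Nat.findGreatest_spec (P := fun i => P ((parent G o)^[i] z)) hj hz
    have hid : i ≤ G.dist o z := Nat.findGreatest_le _
    have hmem : (parent G o)^[i] z ∈ V := by
      refine ⟨hPi, fun m hm hm' => ?_⟩
      rw [dist_iterate_parent hG.1] at hm'
      rw [← Function.iterate_add_apply]
      exact Nat.findGreatest_is_greatest (P := fun i => P ((parent G o)^[i] z))
        (n := G.dist o z) (by omega) (by omega)
    refine Set.mem_iUnion.2 ⟨⟨_, hmem⟩, Set.mem_iUnion.2 ⟨i - j, ?_⟩⟩
    rw [Nat.add_sub_cancel' hji]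
    exact mem_generation_iterate hG.1 hid
  calc _ ≤ ∑' v : V, mu G q o α (⋃ k, (generation G o (v : X) (j + k) : Set X)) :=
        (measure_mono hsub).trans (measure_iUnion_le _)
    _ ≤ ∑' v : V, ENNReal.ofReal (2 * (1 - q * decay q α)⁻¹ * (q * decay q α) ^ j * s⁻¹) *
          ν (sector G o (v : X)) := by
        refine ENNReal.tsum_le_tsum fun v => (mu_iUnion_generation_le hG hq hα v j).trans ?_
        rw [← ofReal_measureReal, ← ENNReal.ofReal_mul (by positivity)]
        refine ENNReal.ofReal_le_ofReal ?_
        rw [mul_assoc _ s⁻¹]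
        refine mul_le_mul_of_nonneg_left ?_ (by positivity)
        rw [← div_eq_inv_mul, le_div_iff₀ hs, mul_comm]
        exact v.2.1.le
    _ ≤ _ := by
        rw [ENNReal.tsum_mul_left]
        gcongr
        refine (tsum_meas_le_meas_iUnion_of_disjoint ν (fun _ => MeasurableSet.of_discrete)
          fun v w hvw => ?_).trans (measure_mono (Set.subset_univ _))
        exact disjoint_sector_of_minimal hG.1 v.2 w.2 fun h => hvw (Subtype.ext h)

/-- Integral operators with kernel dominated by `ancestorSum` satisfy a weak type estimate. -/
theorem weakType_of_le_ancestorSum (hG : IsHomogeneousTree G q) (hq : 2 ≤ q) (hα : 1 < α) {C : ℝ}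
    (hC : 0 ≤ C) {K : X → X → ℝ} (hK : ∀ z x, |K z x| ≤ C * ancestorSum G q o α z x) :
    ∃ D : ℝ≥0, ∀ f : X → ℂ, Integrable f (mu G q o α) → ∀ t : ℝ, 0 < t →
      mu G q o α {z | t < ‖∫ x, (K z x : ℂ) * f x ∂(mu G q o α)‖} ≤
        ENNReal.ofReal (D / t) * ∫⁻ x, ‖f x‖ₑ ∂(mu G q o α) := by
  have hw := decay_pos (α := α) hq
  have h0 := mul_decay_pos (α := α) hq
  have h1 := mul_decay_lt_one hq hα
  -- With levels proportional to `r ^ j`, the gain `r ^ (2 * j)` divided by the level is still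
  -- summable.
  set r := √(q * decay q α) with hr
  have hr0 : 0 < r := Real.sqrt_pos.2 h0
  have hr1 : r < 1 := by rwa [hr, Real.sqrt_lt' one_pos, one_pow]
  have hrr : q * decay q α = r * r := (Real.mul_self_sqrt h0.le).symm
  have h1r := sub_pos.2 hr1
  have h1ρ := sub_pos.2 h1
  -- The levels `c * t * r ^ j` sum to `t / (C + 1)`, so `C` times the sum is at most `t`; the `+ 1`
  -- allows `C = 0`.
  set c := (1 - r) / (C + 1) with hc
  have hc0 : 0 < c := by positivity
  set A := 2 * (1 - q * decay q α)⁻¹ * c⁻¹ with hA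
  have hA0 : 0 ≤ A := by positivity
  refine ⟨Real.toNNReal (A * (1 - r)⁻¹), fun f hf t ht => ?_⟩
  set ν := (mu G q o α).withDensity fun x => ‖f x‖ₑ with hν
  have hνfin : IsFiniteMeasure ν := isFiniteMeasure_withDensity hf.2.ne
  have hνS : ∀ S : Set X, ν.real S = ∫ x in S, ‖f x‖ ∂(mu G q o α) := by
    intro S
    rw [integral_norm_eq_lintegral_enorm hf.1.restrict, Measure.real, hν,
      withDensity_apply _ MeasurableSet.of_discrete]
  have hT : ∀ z, ‖∫ x, (K z x : ℂ) * f x ∂(mu G q o α)‖ ≤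
      C * ∑ j ∈ Finset.range (G.dist o z + 1), (decay q α)⁻¹ ^ G.dist o ((parent G o)^[j] z) *
        ν.real (sector G o ((parent G o)^[j] z)) := by
    intro z
    have hi : ∀ j ∈ Finset.range (G.dist o z + 1),
        Integrable (fun x => (decay q α)⁻¹ ^ G.dist o ((parent G o)^[j] z) *
          (sector G o ((parent G o)^[j] z)).indicator (fun x => ‖f x‖) x) (mu G q o α) :=
      fun j _ => (hf.norm.indicator MeasurableSet.of_discrete).const_mul _
    simp only [hνS]
    rw [Finset.sum_congr rfl fun j _ => by
      rw [← integral_indicator MeasurableSet.of_discrete, ← integral_const_mul],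
      ← integral_finsetSum _ hi, ← integral_const_mul]
    refine norm_integral_le_of_norm_le ((integrable_finsetSum _ hi).const_mul C)
      (Filter.Eventually.of_forall fun x => ?_)
    rw [norm_mul, Complex.norm_real, Real.norm_eq_abs]
    refine (mul_le_mul_of_nonneg_right (hK z x) (norm_nonneg _)).trans (le_of_eq ?_)
    rw [ancestorSum, mul_assoc, Finset.sum_mul]
    congr 1
    refine Finset.sum_congr rfl fun j _ => ?_
    rw [mul_assoc]
    congr 1
    by_cases hx : x ∈ sector G o ((parent G o)^[j] z) <;> simp [hx]
  have hsub : {z | t < ‖∫ x, (K z x : ℂ) * f x ∂(mu G q o α)‖} ⊆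
      ⋃ j, {z | j ≤ G.dist o z ∧ (c * t * r ^ j) * decay q α ^ G.dist o ((parent G o)^[j] z) <
        ν.real (sector G o ((parent G o)^[j] z))} := by
    -- If no ancestor of `z` is heavy at its level, summing the levels bounds the integral by `t`.
    intro z hz
    by_contra hcon
    simp only [Set.mem_iUnion, Set.mem_ofPred_eq, not_exists, not_and, not_lt] at hcon
    refine (not_le.2 hz) ((hT z).trans ?_)
    calc _ ≤ C * ∑ j ∈ Finset.range (G.dist o z + 1), c * t * r ^ j := by
          refine mul_le_mul_of_nonneg_left (Finset.sum_le_sum fun j hj => ?_) hC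
          rw [inv_pow, ← div_eq_inv_mul, div_le_iff₀ (by positivity)]
          exact hcon j (by have := Finset.mem_range.1 hj; omega)
      _ ≤ C * (c * t * (1 - r)⁻¹) := by
          rw [← Finset.mul_sum]
          gcongr
          rw [← tsum_geometric_of_lt_one hr0.le hr1]
          exact (summable_geometric_of_lt_one hr0.le hr1).sum_le_tsum _ fun j _ => by positivity
      _ = C / (C + 1) * t := by
          rw [hc]
          field_simp
      _ ≤ t := by
          refine mul_le_of_le_one_left ht.le ?_
          rw [div_le_one (by positivity)]
          linarith
  have hsum := (hasSum_geometric_of_lt_one hr0.le hr1).mul_left (A / t)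
  calc _ ≤ ∑' j, mu G q o α {z | j ≤ G.dist o z ∧
        (c * t * r ^ j) * decay q α ^ G.dist o ((parent G o)^[j] z) <
          ν.real (sector G o ((parent G o)^[j] z))} :=
        (measure_mono hsub).trans (measure_iUnion_le _)
    _ ≤ ∑' j, ENNReal.ofReal (A / t * r ^ j) * ν Set.univ := by
        refine ENNReal.tsum_le_tsum fun j =>
          (mu_heavy_le hG hq hα ν (by positivity) j).trans (le_of_eq ?_)
        congr 2
        rw [hA, hrr, mul_pow]
        field_simp
    _ = _ := by
        rw [ENNReal.tsum_mul_right, ← ENNReal.ofReal_tsum_of_nonneg (fun j => by positivity)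
          hsum.summable, hsum.tsum_eq, hν, withDensity_apply _ MeasurableSet.univ,
          Measure.restrict_univ]
        congr 2
        rw [Real.coe_toNNReal _ (by positivity)]
        ring

end WeakType

/-! ### Identification with the Bergman projector -/

section Projector

variable [MeasurableSpace X] [DiscreteMeasurableSpace X] {G : SimpleGraph X} [G.LocallyFinite]
  {q : ℕ} {o : X} {α : ℝ}

/-- The integral operator with the bounded kernels `K z`. -/
def kernelOperator (K : X → X → ℝ) (hK : ∀ z, ∃ B, ∀ x, |K z x| ≤ B) :
    Lp ℂ 1 (mu G q o α) →ₗ[ℂ] (X → ℂ) where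
  toFun f z := ∫ x, (K z x : ℂ) * f x ∂(mu G q o α)
  map_add' f g := by
    funext z
    obtain ⟨B, hB⟩ := hK z
    rw [Pi.add_apply, ← integral_add
      (integrable_mul_of_bounded hB (memLp_one_iff_integrable.1 (Lp.memLp f)))
      (integrable_mul_of_bounded hB (memLp_one_iff_integrable.1 (Lp.memLp g)))]
    refine integral_congr_ae ?_
    filter_upwards [Lp.coeFn_add f g] with x hx
    rw [hx, Pi.add_apply, mul_add]
  map_smul' c f := by
    funext z
    rw [Pi.smul_apply, RingHom.id_apply, smul_eq_mul, ← integral_const_mul]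
    refine integral_congr_ae ?_
    filter_upwards [Lp.coeFn_smul c f] with x hx
    rw [hx, Pi.smul_apply, smul_eq_mul]
    ring

/-- A bounded harmonic kernel that reproduces the values at `z` computes the Bergman projector. -/
theorem Represents.integral_eq_bergmanProjector [Fact (2 ≤ q)] [IsFiniteMeasure (mu G q o α)]
    {z : X} {k : X → ℝ} (hk : Represents G q o α k fun g => g z) (F : Lp ℂ 2 (mu G q o α)) :
    ∫ x, (k x : ℂ) * F x ∂(mu G q o α) = bergmanProjector G q o α F z := by
  obtain ⟨B, hB⟩ := hk.bounded
  have hmem : MemLp (fun x => (k x : ℂ)) 2 (mu G q o α) :=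
    MemLp.of_bound Measurable.of_discrete.aestronglyMeasurable B
      (Filter.Eventually.of_forall fun x => by simpa using hB x)
  have hinner : ∀ H : Lp ℂ 2 (mu G q o α),
      inner ℂ (hmem.toLp _) H = ∫ x, (k x : ℂ) * H x ∂(mu G q o α) := by
    intro H
    rw [L2.inner_def]
    refine integral_congr_ae ?_
    filter_upwards [hmem.coeFn_toLp] with x hx
    rw [hx, RCLike.inner_apply, Complex.conj_ofReal, mul_comm]
  have hkmem : hmem.toLp _ ∈ bergmanSpace G q o α := by
    change IsHarmonic G q _
    rw [funext (forall_of_ae hmem.coeFn_toLp), isHarmonic_iff]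
    intro v
    exact_mod_cast hk.harmonic v
  have hP : bergmanProjector G q o α F ∈ bergmanSpace G q o α :=
    Submodule.starProjection_apply_mem _ F
  -- With `P` the projection, `⟪k, P F⟫ = ⟪P k, F⟫ = ⟪k, F⟫`, while the reproducing property turns
  -- the left side into `P F z`.
  rw [← hk.integral _ hP ((Lp.memLp _).integrable one_le_two), ← hinner, ← hinner,
    bergmanProjector, ← Submodule.inner_starProjection_left_eq_right,
    Submodule.starProjection_eq_self_iff.2 hkmem]

end Projector

end BergmanTree

end

theorem mainTheorem6 {X : Type*} [MeasurableSpace X] [DiscreteMeasurableSpace X]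
    (G : SimpleGraph X) [G.LocallyFinite] (q : ℕ) [Fact (2 ≤ q)]
    (hG : BergmanTree.IsHomogeneousTree G q) (o : X) (α : ℝ) (hα : 1 < α) :
    ∃ T : Lp ℂ 1 (BergmanTree.mu G q o α) →ₗ[ℂ] (X → ℂ),
      (∀ (f : X → ℂ) (hf₂ : MemLp f 2 (BergmanTree.mu G q o α)),
        ∃ hf₁ : MemLp f 1 (BergmanTree.mu G q o α),
          T (hf₁.toLp f) = BergmanTree.bergmanProjector G q o α (hf₂.toLp f)) ∧
      BergmanTree.IsWeakTypeOneOne (BergmanTree.mu G q o α) T := by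
  have hq : 2 ≤ q := Fact.out
  -- Finiteness gives the inclusion of `L²` in `L¹` and puts bounded kernels in `L²`.
  have : IsFiniteMeasure (BergmanTree.mu G q o α) := BergmanTree.isFiniteMeasure_mu hG hq hα
  obtain ⟨C, K, hC, hK⟩ := BergmanTree.exists_kernel (o := o) hG hq hα
  refine ⟨BergmanTree.kernelOperator K fun z => (hK z).1.bounded, fun f hf₂ =>
    ⟨hf₂.mono_exponent one_le_two, ?_⟩, ?_⟩
  · funext z
    rw [← (hK z).1.integral_eq_bergmanProjector]
    refine integral_congr_ae ?_
    filter_upwards [(hf₂.mono_exponent one_le_two).coeFn_toLp, hf₂.coeFn_toLp] with x h₁ h₂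
    rw [h₁, h₂]
  · obtain ⟨D, hD⟩ := BergmanTree.weakType_of_le_ancestorSum hG hq hα hC fun z => (hK z).2
    refine ⟨D, fun f t ht => ?_⟩
    have hf := memLp_one_iff_integrable.1 (Lp.memLp f)
    refine (hD f hf t ht).trans (le_of_eq ?_)
    rw [← ofReal_integral_norm_eq_lintegral_enorm hf, ← L1.norm_eq_integral_norm,
      ← ENNReal.ofReal_mul (by positivity)]
    congr 1
    ring
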